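/- Let $X$ be a separable real Banach space, regarded as a subspace of its bidual $X^{**}$ through the canonical embedding, and let $Z$ be a linear subspace of $X^{**}$ such that $X^{**}=X\oplus_1 Z$; that is, every element of $X^{**}$ can be written uniquely as $x+z$ with $x\in X$, $z\in Z$, and $\|x+z\|=\|x\|+\|z\|$ for all $x\in X$, $z\in Z$ (so $X$ is an $L$-embedded space). A real Banach space $Y$ is said to have the Daugavet property if $\|I+T\|=1+\|T\|$ for every bounded linear operator $T\colon Y\to Y$ of rank one, where $I$ is the identity operator of $Y$. Write $B_Z$ and $B_{X^{**}}$ for the closed unit balls of $Z$ and $X^{**}$. Then the following are equivalent: 1. $X^*$ has the Daugavet property. 2. $X$ has the Daugavet property. 3. $B_Z$ is dense in $B_{X^{**}}$ for the weak-star topology $\sigma(X^{**},X^*)$. -/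

import Mathlib

/-- A real normed space `X` has the Daugavet property if `‖I + T‖ = 1 + ‖T‖` for every
bounded linear operator `T : X → X` of rank one. -/
def DaugavetProperty (X : Type*) [NormedAddCommGroup X] [NormedSpace ℝ X] : Prop :=
  ∀ T : X →L[ℝ] X, (T : X →ₗ[ℝ] X).rank = 1 →
    ‖ContinuousLinearMap.id ℝ X + T‖ = 1 + ‖T‖

/-- `E = M ⊕₁ N`: the space `E` is the algebraic direct sum of the subspaces `M` and `N`, and
`‖m + n‖ = ‖m‖ + ‖n‖` for all `m ∈ M` and `n ∈ N`. -/
def IsL1DirectSum {E : Type*} [NormedAddCommGroup E] [NormedSpace ℝ E]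
    (M N : Submodule ℝ E) : Prop :=
  IsCompl M N ∧ ∀ m ∈ M, ∀ n ∈ N, ‖m + n‖ = ‖m‖ + ‖n‖

/-- The canonical copy of `X` in its bidual `X**`. -/
noncomputable def canonicalImage (X : Type*) [NormedAddCommGroup X] [NormedSpace ℝ X] :
    Submodule ℝ (StrongDual ℝ (StrongDual ℝ X)) :=
  LinearMap.range (NormedSpace.inclusionInDoubleDual ℝ X).toLinearMap

/-- For subsets `A`, `B` of a dual space `Y*`: `A` is a weak-star dense subset of `B`. -/
def IsWeakStarDenseIn {Y : Type*} [NormedAddCommGroup Y] [NormedSpace ℝ Y]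
    (A B : Set (StrongDual ℝ Y)) : Prop :=
  A ⊆ B ∧ StrongDual.toWeakDual '' B ⊆ closure (StrongDual.toWeakDual '' A)

/-! A rank-one operator is `f ⊗ v`, and `I + f ⊗ v` has the same norm as its adjoint, which gives 1
→ 2. For 2 → 3, every slice of the bidual ball contains a smaller one whose elements `w` nearly
satisfy `‖x + w‖ = 1 + ‖x‖`. Iterating over a dense sequence of `x`, weak-star compactness yields
`u` in the slice with `‖x + u‖ ≥ 1 + ‖x‖` for all `x`, and the ℓ₁-decomposition forces `u ∈ Z`. So
`B_Z` meets every slice, and Hahn–Banach gives density. For 3 → 1, split `φ = v + z`. Density gives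
an `x` in the ball with `‖x + f x • v‖` and `|f x|` both almost maximal; adding `f x • z` then costs
exactly `|f x| * ‖z‖`. -/

open NormedSpace Set Metric

/-! ### Rank-one operators and duality -/

section RankOne

set_option maxSynthPendingDepth 3

variable {Y : Type*} [NormedAddCommGroup Y] [NormedSpace ℝ Y]

/-- The adjoint of `I + f ⊗ v` maps `g` to `g + g v • f`. -/
theorem norm_add_apply_smul_le (f g : StrongDual ℝ Y) (v : Y) :
    ‖g + g v • f‖ ≤ ‖g‖ * ‖ContinuousLinearMap.id ℝ Y + f.smulRight v‖ := by
  have h : g + g v • f = g.comp (ContinuousLinearMap.id ℝ Y + f.smulRight v) := by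
    ext y
    simp [mul_comm]
  rw [h]
  exact ContinuousLinearMap.opNorm_comp_le _ _

theorem rank_smulRight_eq_one {f : StrongDual ℝ Y} {v : Y} (hf : f ≠ 0) (hv : v ≠ 0) :
    ((f.smulRight v : Y →L[ℝ] Y) : Y →ₗ[ℝ] Y).rank = 1 := by
  have hf' : (f : Y →ₗ[ℝ] ℝ) ≠ 0 := fun h => hf (ContinuousLinearMap.coe_injective h)
  have h : LinearMap.range ((f.smulRight v : Y →L[ℝ] Y) : Y →ₗ[ℝ] Y) = Submodule.span ℝ {v} :=
    LinearMap.range_smulRight_apply hf' v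
  rw [LinearMap.rank, h, Module.rank_eq_one_iff_finrank_eq_one, finrank_span_singleton hv]

theorem exists_eq_smulRight_of_rank_eq_one {T : Y →L[ℝ] Y}
    (hT : (T : Y →ₗ[ℝ] Y).rank = 1) :
    ∃ (f : StrongDual ℝ Y) (v : Y), f ≠ 0 ∧ v ≠ 0 ∧ T = f.smulRight v := by
  obtain ⟨v, -, hv, hle⟩ := (rank_submodule_eq_one_iff _).1 hT
  obtain ⟨g, hg⟩ := SeparatingDual.exists_eq_one (R := ℝ) hv
  have key : T = (g.comp T).smulRight v := by
    ext y
    obtain ⟨c, hc⟩ := Submodule.mem_span_singleton.1 (hle ⟨y, rfl⟩)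
    have hc' : T y = c • v := hc.symm
    simp [hc', hg]
  refine ⟨g.comp T, v, fun h => ?_, hv, key⟩
  rw [h] at key
  have h0 : T = 0 := by
    rw [key]
    ext y
    simp
  rw [h0] at hT
  simp [LinearMap.rank_zero] at hT

theorem daugavetProperty_iff : DaugavetProperty Y ↔
    ∀ (f : StrongDual ℝ Y) (v : Y), f ≠ 0 → v ≠ 0 →
      1 + ‖f‖ * ‖v‖ ≤ ‖ContinuousLinearMap.id ℝ Y + f.smulRight v‖ := by
  constructor
  · intro h f v hf hv
    rw [h _ (rank_smulRight_eq_one hf hv), ContinuousLinearMap.norm_smulRight_apply]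
  · intro h T hT
    obtain ⟨f, v, hf, hv, rfl⟩ := exists_eq_smulRight_of_rank_eq_one hT
    refine le_antisymm ((norm_add_le _ _).trans ?_) ?_
    · gcongr
      exact ContinuousLinearMap.norm_id_le
    · rw [ContinuousLinearMap.norm_smulRight_apply]
      exact h f v hf hv

theorem exists_lt_apply_of_lt_norm {f : StrongDual ℝ Y} {r : ℝ} (hr : r < ‖f‖) :
    ∃ y : Y, ‖y‖ ≤ 1 ∧ r < f y := by
  obtain ⟨y, hy, hfy⟩ := f.exists_lt_apply_of_lt_opNorm hr
  rw [Real.norm_eq_abs, lt_abs] at hfy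
  rcases hfy with h | h
  · exact ⟨y, hy.le, h⟩
  · exact ⟨-y, by simpa using hy.le, by simpa using h⟩

theorem norm_inclusionInDoubleDual (y : Y) : ‖inclusionInDoubleDual ℝ Y y‖ = ‖y‖ :=
  (inclusionInDoubleDualLi (E := Y) ℝ).norm_map y

theorem apply_le_norm_of_norm_le_one {f : StrongDual ℝ Y} {y : Y} (hy : ‖y‖ ≤ 1) :
    |f y| ≤ ‖f‖ := by
  simpa using f.le_opNorm_of_le hy

/-- The Daugavet property passes from the dual to the space. -/
theorem DaugavetProperty.of_strongDual (h : DaugavetProperty (StrongDual ℝ Y)) :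
    DaugavetProperty Y := by
  rw [daugavetProperty_iff] at h ⊢
  intro f v hf hv
  have hv' : inclusionInDoubleDual ℝ Y v ≠ 0 := by
    rwa [← norm_ne_zero_iff, norm_inclusionInDoubleDual, norm_ne_zero_iff]
  have := h (inclusionInDoubleDual ℝ Y v) f hv' hf
  rw [norm_inclusionInDoubleDual, mul_comm] at this
  refine this.trans (ContinuousLinearMap.opNorm_le_bound _ (norm_nonneg _) fun g => ?_)
  rw [mul_comm]
  exact norm_add_apply_smul_le f g v

end RankOne

/-! ### Slices and weak-star density -/

section WeakStar

set_option maxSynthPendingDepth 3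

variable {Y : Type*} [NormedAddCommGroup Y] [NormedSpace ℝ Y]

/-- The weak-star closed slice of the dual unit ball where evaluation at `h` is at least `c`. -/
def weakStarSlice (h : Y) (c : ℝ) : Set (StrongDual ℝ Y) :=
  {w | ‖w‖ ≤ 1 ∧ c ≤ w h}

theorem isClosed_preimage_weakStarSlice (h : Y) (c : ℝ) :
    IsClosed (WeakDual.toStrongDual ⁻¹' weakStarSlice h c) := by
  have h1 : WeakDual.toStrongDual ⁻¹' weakStarSlice h c =
      WeakDual.toStrongDual ⁻¹' closedBall (0 : StrongDual ℝ Y) 1 ∩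
        {w : WeakDual ℝ Y | c ≤ w h} := by
    ext w
    simp [weakStarSlice]
  rw [h1]
  exact (WeakDual.isClosed_closedBall _ _).inter
    (isClosed_le continuous_const (WeakDual.eval_continuous h))

theorem isCompact_preimage_weakStarSlice (h : Y) (c : ℝ) :
    IsCompact (WeakDual.toStrongDual ⁻¹' weakStarSlice h c) :=
  (WeakDual.isCompact_closedBall (𝕜 := ℝ) (0 : StrongDual ℝ Y) 1).of_isClosed_subset
    (isClosed_preimage_weakStarSlice h c) fun w hw => by
      simpa using (show ‖WeakDual.toStrongDual w‖ ≤ 1 from hw.1)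

theorem weakStarSlice_nonempty {h : Y} {c : ℝ} (hc : c < ‖h‖) :
    (weakStarSlice h c).Nonempty := by
  obtain ⟨g, hg, hgh⟩ := exists_dual_vector'' ℝ h
  exact ⟨g, hg, by rw [hgh]; exact hc.le⟩

/-- A convex set meeting all slices of the dual unit ball is weak-star dense in it. -/
theorem closedBall_subset_closure_of_convex {C : Set (StrongDual ℝ Y)} (hC : Convex ℝ C)
    (h0 : 0 ∈ C) (hs : ∀ (h : Y) (c : ℝ), h ≠ 0 → c < ‖h‖ → ∃ w ∈ C, c ≤ w h) :
    StrongDual.toWeakDual '' closedBall (0 : StrongDual ℝ Y) 1 ⊆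
      closure (StrongDual.toWeakDual '' C) := by
  rintro _ ⟨w, hw, rfl⟩
  by_contra hn
  have hconv : Convex ℝ (StrongDual.toWeakDual '' C) :=
    hC.linear_image (StrongDual.toWeakDual (𝕜 := ℝ) (E := Y)).toLinearMap
  have : LocallyConvexSpace ℝ (WeakDual ℝ Y) :=
    inferInstanceAs (LocallyConvexSpace ℝ (WeakBilin (topDualPairing ℝ Y)))
  obtain ⟨φ, s, hlt, hgt⟩ := geometric_hahn_banach_closed_point hconv.closure isClosed_closure hn
  -- Weak-star continuous functionals are evaluations at points of `Y`.
  obtain ⟨h, rfl⟩ := LinearMap.dualEmbedding_surjective (topDualPairing ℝ Y) φ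
  have hlt' : ∀ v ∈ C, v h < s := fun v hv => hlt _ (subset_closure ⟨v, hv, rfl⟩)
  have hgt' : s < w h := hgt
  -- Since `0 ∈ C`, the separating level is positive, which forces `h ≠ 0`.
  have hs0 : 0 < s := by simpa using hlt' 0 h0
  have hw1 : ‖w‖ ≤ 1 := by simpa using hw
  have hwh : w h ≤ ‖h‖ := (le_abs_self _).trans (by simpa using w.le_of_opNorm_le hw1 h)
  have hpos : 0 < ‖h‖ := by linarith
  obtain ⟨v, hv, hsv⟩ := hs h s (norm_pos_iff.1 hpos) (by linarith)
  linarith [hlt' v hv]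

theorem IsWeakStarDenseIn.exists_lt_apply {A : Set (StrongDual ℝ Y)}
    (hA : IsWeakStarDenseIn A (closedBall 0 1)) {h : Y} {c : ℝ} (hc : c < ‖h‖) :
    ∃ w ∈ A, ‖w‖ ≤ 1 ∧ c < w h := by
  obtain ⟨g, hg, hgh⟩ := exists_dual_vector'' ℝ h
  have hmem := hA.2 ⟨g, by simpa using hg, rfl⟩
  have hopen : IsOpen {w : WeakDual ℝ Y | c < w h} :=
    isOpen_lt continuous_const (WeakDual.eval_continuous h)
  have hgc : c < g h := by rw [hgh]; exact hc
  obtain ⟨_, hw, v, hv, rfl⟩ := mem_closure_iff.1 hmem _ hopen hgc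
  exact ⟨v, hv, by simpa using hA.1 hv, hw⟩

end WeakStar

/-! ### Shrinking slices in a Daugavet space -/

section Slices

set_option maxSynthPendingDepth 3

variable {X : Type*} [NormedAddCommGroup X] [NormedSpace ℝ X]

/-- Take `h' = g + g x • h` with `g` in the dual ball and `‖h'‖` almost `1 + ‖h‖ * ‖x‖`. If `w`
nearly norms `h'`, then `w g ≈ 1`, `w h ≈ ‖h‖` and `g x ≈ ‖x‖`; evaluating `x + w` at `g` gives the
estimate. -/
theorem DaugavetProperty.exists_slice_of_ne_zero (hX : DaugavetProperty X) {x : X} (hx : x ≠ 0)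
    {h : StrongDual ℝ X} (hh : h ≠ 0) {c : ℝ} (hc : c < ‖h‖) {ε : ℝ} (hε : 0 < ε) :
    ∃ (h' : StrongDual ℝ X) (c' : ℝ), h' ≠ 0 ∧ c' < ‖h'‖ ∧
      weakStarSlice h' c' ⊆ weakStarSlice h c ∧
      ∀ w ∈ weakStarSlice h' c', 1 + ‖x‖ - ε ≤ ‖inclusionInDoubleDual ℝ X x + w‖ := by
  have hxp : 0 < ‖x‖ := norm_pos_iff.2 hx
  have hhp : 0 < ‖h‖ := norm_pos_iff.2 hh
  -- In order, the bounds on `η` serve `w g ≥ 1 - ε / 2`, `g x ≥ ‖x‖ - ε / 2`, `w h ≥ c` and `w h >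
  -- 0`.
  obtain ⟨η, hη, hη1, hη2, hη3, hη4⟩ : ∃ η : ℝ, 0 < η ∧ η ≤ ε / 2 ∧ η ≤ ε / 2 * ‖h‖ ∧
      η ≤ (‖h‖ - c) * ‖x‖ ∧ η < ‖h‖ * ‖x‖ := by
    have h3 : 0 < (‖h‖ - c) * ‖x‖ := mul_pos (sub_pos.2 hc) hxp
    have h4 : 0 < ‖h‖ * ‖x‖ / 2 := by positivity
    refine ⟨min (min (ε / 2) (ε / 2 * ‖h‖)) (min ((‖h‖ - c) * ‖x‖) (‖h‖ * ‖x‖ / 2)),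
      lt_min (lt_min (by positivity) (by positivity)) (lt_min h3 h4), ?_, ?_, ?_, ?_⟩
    · exact (min_le_left _ _).trans (min_le_left _ _)
    · exact (min_le_left _ _).trans (min_le_right _ _)
    · exact (min_le_right _ _).trans (min_le_left _ _)
    · exact ((min_le_right _ _).trans (min_le_right _ _)).trans_lt (by linarith)
  -- a norm-one functional almost attaining the norm of the adjoint
  obtain ⟨g, hg, hgx, hgn⟩ : ∃ g : StrongDual ℝ X, ‖g‖ ≤ 1 ∧ 0 ≤ g x ∧
      1 + ‖h‖ * ‖x‖ - η < ‖g + g x • h‖ := by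
    have hD := daugavetProperty_iff.1 hX h x hh hx
    obtain ⟨y, hy, hyn⟩ := (ContinuousLinearMap.id ℝ X + h.smulRight x).exists_lt_apply_of_lt_opNorm
      (show 1 + ‖h‖ * ‖x‖ - η < _ from lt_of_lt_of_le (by linarith) hD)
    obtain ⟨g, hg, hgy⟩ := exists_dual_vector'' ℝ ((ContinuousLinearMap.id ℝ X + h.smulRight x) y)
    have hgy' : 1 + ‖h‖ * ‖x‖ - η < (g + g x • h) y := by
      refine hyn.trans_eq (hgy.symm.trans ?_)
      simp [mul_comm]
    have hgn : 1 + ‖h‖ * ‖x‖ - η < ‖g + g x • h‖ :=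
      hgy'.trans_le ((le_abs_self _).trans (apply_le_norm_of_norm_le_one hy.le))
    rcases le_total 0 (g x) with h0 | h0
    · exact ⟨g, hg, h0, hgn⟩
    · refine ⟨-g, by simpa using hg, by simpa using h0, ?_⟩
      have : -g + (-g) x • h = -(g + g x • h) := by
        ext y
        simp [add_comm]
      rwa [this, norm_neg]
  have hgx1 : g x ≤ ‖x‖ := (le_abs_self _).trans (by simpa using g.le_of_opNorm_le hg x)
  refine ⟨g + g x • h, 1 + ‖h‖ * ‖x‖ - η, ?_, hgn, ?_⟩
  · rw [← norm_pos_iff]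
    linarith
  have key : ∀ w ∈ weakStarSlice (g + g x • h) (1 + ‖h‖ * ‖x‖ - η),
      ‖w‖ ≤ 1 ∧ w g ≤ 1 ∧ w h ≤ ‖h‖ ∧ 0 < w h ∧ 1 + ‖h‖ * ‖x‖ - η ≤ w g + g x * w h := by
    rintro w ⟨hw, hwc⟩
    have h1 : w g ≤ 1 := (le_abs_self _).trans ((w.le_of_opNorm_le hw g).trans (by simpa using hg))
    have h2 : w h ≤ ‖h‖ := (le_abs_self _).trans (by simpa using w.le_of_opNorm_le hw h)
    have h3 : 1 + ‖h‖ * ‖x‖ - η ≤ w g + g x * w h := by simpa using hwc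
    refine ⟨hw, h1, h2, ?_, h3⟩
    by_contra h4
    have := mul_nonpos_of_nonneg_of_nonpos hgx (not_lt.1 h4)
    linarith
  refine ⟨fun w hw => ?_, fun w hw => ?_⟩
  · obtain ⟨hw1, hwg, hwh, hwp, hsum⟩ := key w hw
    refine ⟨hw1, ?_⟩
    have : g x * w h ≤ ‖x‖ * w h := by gcongr
    refine le_of_mul_le_mul_left ?_ hxp
    linarith
  · obtain ⟨hw1, hwg, hwh, hwp, hsum⟩ := key w hw
    have h1 : g x * w h ≤ g x * ‖h‖ := by gcongr
    have h2 : g x * ‖h‖ ≤ ‖x‖ * ‖h‖ := by gcongr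
    have h3 : ‖x‖ - ε / 2 ≤ g x := by
      refine le_of_mul_le_mul_right ?_ hhp
      linarith
    have h4 : (inclusionInDoubleDual ℝ X x + w) g ≤ ‖inclusionInDoubleDual ℝ X x + w‖ :=
      (le_abs_self _).trans (apply_le_norm_of_norm_le_one hg)
    have h5 : (inclusionInDoubleDual ℝ X x + w) g = g x + w g := by simp
    linarith

theorem DaugavetProperty.exists_slice (hX : DaugavetProperty X) (x : X)
    {h : StrongDual ℝ X} (hh : h ≠ 0) {c : ℝ} (hc : c < ‖h‖) {ε : ℝ} (hε : 0 < ε) :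
    ∃ (h' : StrongDual ℝ X) (c' : ℝ), h' ≠ 0 ∧ c' < ‖h'‖ ∧
      weakStarSlice h' c' ⊆ weakStarSlice h c ∧
      ∀ w ∈ weakStarSlice h' c', 1 + ‖x‖ - ε ≤ ‖inclusionInDoubleDual ℝ X x + w‖ := by
  -- For `x = 0` there is no rank-one operator to use; any `y ≠ 0` works, by the triangle
  -- inequality.
  by_cases hx : x = 0
  · obtain ⟨y, hy⟩ : ∃ y : X, y ≠ 0 := by
      by_contra! hall
      exact hh (by ext y; simp [hall y])
    obtain ⟨h', c', h1, h2, h3, h4⟩ := hX.exists_slice_of_ne_zero hy hh hc hε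
    refine ⟨h', c', h1, h2, h3, fun w hw => ?_⟩
    have h5 := (h4 w hw).trans (norm_add_le _ _)
    rw [norm_inclusionInDoubleDual] at h5
    simp only [hx, map_zero, zero_add, norm_zero]
    linarith
  · exact hX.exists_slice_of_ne_zero hx hh hc hε

/-- In a separable Daugavet space every slice of the bidual ball contains an `ℓ₁`-orthogonal
element to the space. -/
theorem DaugavetProperty.exists_l1_orthogonal [TopologicalSpace.SeparableSpace X]
    (hX : DaugavetProperty X) {h : StrongDual ℝ X} (hh : h ≠ 0) {c : ℝ} (hc : c < ‖h‖) :
    ∃ u ∈ weakStarSlice h c, ∀ x : X, 1 + ‖x‖ ≤ ‖inclusionInDoubleDual ℝ X x + u‖ := by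
  let P := {p : StrongDual ℝ X × ℝ // p.1 ≠ 0 ∧ p.2 < ‖p.1‖}
  -- Unpairing the index treats every dense point with every tolerance.
  let d : ℕ → X := fun n => TopologicalSpace.denseSeq X n.unpair.1
  let ε : ℕ → ℝ := fun n => 1 / ((n.unpair.2 : ℝ) + 1)
  have hstep : ∀ (n : ℕ) (p : P), ∃ q : P,
      weakStarSlice q.1.1 q.1.2 ⊆ weakStarSlice p.1.1 p.1.2 ∧
      ∀ w ∈ weakStarSlice q.1.1 q.1.2,
        1 + ‖d n‖ - ε n ≤ ‖inclusionInDoubleDual ℝ X (d n) + w‖ := by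
    rintro n ⟨⟨k, b⟩, hk, hb⟩
    obtain ⟨h', c', h1, h2, h3, h4⟩ := hX.exists_slice (d n) hk hb
      (show 0 < ε n from Nat.one_div_pos_of_nat)
    exact ⟨⟨(h', c'), h1, h2⟩, h3, h4⟩
  choose next hsub hnorm using hstep
  let p : ℕ → P := fun n => Nat.rec ⟨(h, c), hh, hc⟩ (fun k q => next k q) n
  obtain ⟨u, hu⟩ := IsCompact.nonempty_iInter_of_sequence_nonempty_isCompact_isClosed
    (fun n => WeakDual.toStrongDual ⁻¹' weakStarSlice (p n).1.1 (p n).1.2)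
    (fun n => preimage_mono (hsub n (p n)))
    (fun n => by
      obtain ⟨w, hw⟩ := weakStarSlice_nonempty (p n).2.2
      exact ⟨StrongDual.toWeakDual w, hw⟩)
    (isCompact_preimage_weakStarSlice _ _)
    (fun n => isClosed_preimage_weakStarSlice _ _)
  rw [mem_iInter] at hu
  refine ⟨WeakDual.toStrongDual u, hu 0, fun x => ?_⟩
  have hclosed : IsClosed {x : X | 1 + ‖x‖ ≤
      ‖inclusionInDoubleDual ℝ X x + WeakDual.toStrongDual u‖} :=
    isClosed_le (by fun_prop) (by fun_prop)
  have hdense := (TopologicalSpace.denseRange_denseSeq X).closure_range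
  refine hclosed.closure_subset_iff.2 ?_ (hdense ▸ mem_univ x)
  rintro _ ⟨m, rfl⟩
  rw [mem_ofPred_eq]
  refine le_of_forall_pos_le_add fun δ hδ => ?_
  obtain ⟨k, hk⟩ := exists_nat_one_div_lt hδ
  -- The estimate of step `n` holds on slice `n + 1`.
  have h1 := hnorm (Nat.pair m k) (p (Nat.pair m k))
    (WeakDual.toStrongDual u) (hu (Nat.pair m k + 1))
  simp only [d, ε, Nat.unpair_pair] at h1
  linarith

end Slices

/-! ### Using the ℓ₁-decomposition of the bidual -/

section LEmbedded

set_option maxSynthPendingDepth 3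

variable {X : Type*} [NormedAddCommGroup X] [NormedSpace ℝ X]
  {Z : Submodule ℝ (StrongDual ℝ (StrongDual ℝ X))}

theorem IsL1DirectSum.norm_inclusion_add
    (hZ : IsL1DirectSum (E := StrongDual ℝ (StrongDual ℝ X)) (canonicalImage X) Z) (x : X)
    {z : StrongDual ℝ (StrongDual ℝ X)} (hz : z ∈ Z) :
    ‖inclusionInDoubleDual ℝ X x + z‖ = ‖x‖ + ‖z‖ := by
  rw [← norm_inclusionInDoubleDual x]
  exact hZ.2 _ ⟨x, rfl⟩ z hz

theorem IsL1DirectSum.exists_eq_add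
    (hZ : IsL1DirectSum (E := StrongDual ℝ (StrongDual ℝ X)) (canonicalImage X) Z)
    (w : StrongDual ℝ (StrongDual ℝ X)) :
    ∃ x : X, ∃ z ∈ Z, w = inclusionInDoubleDual ℝ X x + z := by
  obtain ⟨_, ⟨x, rfl⟩, z, hz, h⟩ :=
    Submodule.mem_sup.1 (hZ.1.sup_eq_top ▸ Submodule.mem_top (x := w))
  exact ⟨x, z, hz, h.symm⟩

/-- If `u = x + z`, testing on `-x` gives `1 + ‖x‖ ≤ ‖z‖`, while `‖x‖ + ‖z‖ ≤ 1`; hence `x = 0`. -/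
theorem IsL1DirectSum.mem_of_l1_orthogonal
    (hZ : IsL1DirectSum (E := StrongDual ℝ (StrongDual ℝ X)) (canonicalImage X) Z)
    {u : StrongDual ℝ (StrongDual ℝ X)} (hu : ‖u‖ ≤ 1)
    (h : ∀ x : X, 1 + ‖x‖ ≤ ‖inclusionInDoubleDual ℝ X x + u‖) : u ∈ Z := by
  obtain ⟨x, z, hz, rfl⟩ := hZ.exists_eq_add u
  have h1 := h (-x)
  rw [map_neg, neg_add_cancel_left, norm_neg] at h1
  rw [hZ.norm_inclusion_add x hz] at hu
  have hx : x = 0 := norm_le_zero_iff.1 (by linarith)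
  simpa [hx] using hz

theorem DaugavetProperty.isWeakStarDenseIn [TopologicalSpace.SeparableSpace X]
    (hX : DaugavetProperty X)
    (hZ : IsL1DirectSum (E := StrongDual ℝ (StrongDual ℝ X)) (canonicalImage X) Z) :
    IsWeakStarDenseIn ((Z : Set (StrongDual ℝ (StrongDual ℝ X))) ∩ closedBall 0 1)
      (closedBall (0 : StrongDual ℝ (StrongDual ℝ X)) 1) := by
  refine ⟨inter_subset_right, closedBall_subset_closure_of_convex
    (Z.convex.inter (convex_closedBall _ _)) ⟨Z.zero_mem, by simp⟩ fun h c hh hc => ?_⟩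
  obtain ⟨u, hu, huX⟩ := hX.exists_l1_orthogonal hh hc
  exact ⟨u, ⟨hZ.mem_of_l1_orthogonal hu.1 huX, by simpa using hu.1⟩, hu.2⟩

/-- If the ball of the complement is weak-star dense, then `I + f ⊗ v` satisfies the
Daugavet estimate on the unit ball of `X`. -/
theorem IsWeakStarDenseIn.exists_norm_add_smul
    (hZ : IsL1DirectSum (E := StrongDual ℝ (StrongDual ℝ X)) (canonicalImage X) Z)
    (hd : IsWeakStarDenseIn ((Z : Set (StrongDual ℝ (StrongDual ℝ X))) ∩ closedBall 0 1)
      (closedBall (0 : StrongDual ℝ (StrongDual ℝ X)) 1))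
    {f : StrongDual ℝ X} (hf : f ≠ 0) (v : X) {η : ℝ} (hη : 0 < η) :
    ∃ x : X, ‖x‖ ≤ 1 ∧ 1 + ‖f‖ * ‖v‖ - η < ‖x + f x • v‖ := by
  have hfp : 0 < ‖f‖ := norm_pos_iff.2 hf
  obtain ⟨δ, hδ, hδf, hδη⟩ : ∃ δ : ℝ, 0 < δ ∧ δ < ‖f‖ ∧ δ * (1 / ‖f‖ + ‖v‖) < η := by
    have hpos : 0 < 1 / ‖f‖ + ‖v‖ := by positivity
    refine ⟨min (‖f‖ / 2) (η / (1 / ‖f‖ + ‖v‖) / 2), lt_min (by positivity) (by positivity),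
      (min_le_left _ _).trans_lt (by linarith), ?_⟩
    rw [← lt_div_iff₀ hpos]
    exact (min_le_right _ _).trans_lt (half_lt_self (by positivity))
  obtain ⟨z, ⟨hzZ, -⟩, hz1, hzf⟩ := hd.exists_lt_apply (sub_lt_self ‖f‖ hδ)
  have hz : 1 - δ / ‖f‖ ≤ ‖z‖ := by
    have h1 : z f ≤ ‖z‖ * ‖f‖ := (le_abs_self _).trans (z.le_opNorm f)
    rw [one_sub_div hfp.ne', div_le_iff₀ hfp]
    linarith
  have hnorm : ‖z + z f • inclusionInDoubleDual ℝ X v‖ = z f * ‖v‖ + ‖z‖ := by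
    rw [add_comm, ← map_smul, hZ.norm_inclusion_add _ hzZ, norm_smul, Real.norm_eq_abs,
      abs_of_pos (by linarith)]
  -- `z` composed with `R` is `z + z f • v`. As `R` is the adjoint of `I + f ⊗ v`, its large norm
  -- descends to a point of `X`.
  have hR := norm_add_apply_smul_le (inclusionInDoubleDual ℝ X v) z f
  set R := ContinuousLinearMap.id ℝ (StrongDual ℝ X) + (inclusionInDoubleDual ℝ X v).smulRight f
  have hlt : 1 + ‖f‖ * ‖v‖ - η < ‖R‖ := by
    have h1 : ‖z‖ * ‖R‖ ≤ ‖R‖ := mul_le_of_le_one_left (norm_nonneg _) hz1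
    have h2 : (‖f‖ - δ) * ‖v‖ ≤ z f * ‖v‖ := by gcongr
    have h3 : δ * (1 / ‖f‖ + ‖v‖) = δ / ‖f‖ + δ * ‖v‖ := by ring
    have h4 : (‖f‖ - δ) * ‖v‖ = ‖f‖ * ‖v‖ - δ * ‖v‖ := by ring
    linarith
  obtain ⟨g, hg, hgR⟩ := R.exists_lt_apply_of_lt_opNorm hlt
  obtain ⟨x, hx, hxR⟩ := exists_lt_apply_of_lt_norm hgR
  refine ⟨x, hx, hxR.trans_le ?_⟩
  have h1 : R g x = g (x + f x • v) := by simp [R, mul_comm]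
  rw [h1]
  exact (le_abs_self _).trans (by simpa using g.le_of_opNorm_le hg.le (x + f x • v))

theorem IsWeakStarDenseIn.daugavetProperty_strongDual
    (hZ : IsL1DirectSum (E := StrongDual ℝ (StrongDual ℝ X)) (canonicalImage X) Z)
    (hd : IsWeakStarDenseIn ((Z : Set (StrongDual ℝ (StrongDual ℝ X))) ∩ closedBall 0 1)
      (closedBall (0 : StrongDual ℝ (StrongDual ℝ X)) 1)) :
    DaugavetProperty (StrongDual ℝ X) := by
  rw [daugavetProperty_iff]
  intro φ f _ hf
  have hfp : 0 < ‖f‖ := norm_pos_iff.2 hf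
  obtain ⟨v, z, hz, rfl⟩ := hZ.exists_eq_add φ
  have hbound : ∀ x : X, ‖x‖ ≤ 1 → ‖x + f x • v‖ + |f x| * ‖z‖ ≤
      ‖ContinuousLinearMap.id ℝ (StrongDual ℝ X) +
        (inclusionInDoubleDual ℝ X v + z).smulRight f‖ := by
    intro x hx
    have h1 := norm_add_apply_smul_le (inclusionInDoubleDual ℝ X v + z)
      (inclusionInDoubleDual ℝ X x) f
    have h2 : inclusionInDoubleDual ℝ X x +
        inclusionInDoubleDual ℝ X x f • (inclusionInDoubleDual ℝ X v + z) =
        inclusionInDoubleDual ℝ X (x + f x • v) + f x • z := by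
      simp only [dual_def, map_add, map_smul, smul_add, add_assoc]
    rw [h2, hZ.norm_inclusion_add _ (Z.smul_mem _ hz), norm_smul, Real.norm_eq_abs,
      norm_inclusionInDoubleDual] at h1
    exact h1.trans (mul_le_of_le_one_left (norm_nonneg _) hx)
  rw [hZ.norm_inclusion_add v hz]
  -- points `x` at which both `f` and `I + f ⊗ v` almost attain their norms
  have happrox : ∀ η : ℝ, 0 < η → ∃ x : X, ‖x‖ ≤ 1 ∧ ‖f‖ - η ≤ |f x| ∧
      1 + ‖f‖ * ‖v‖ - η ≤ ‖x + f x • v‖ := by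
    intro η hη
    -- For `v ≠ 0`, `‖x + f x • v‖ ≤ 1 + |f x| * ‖v‖` makes `|f x|` large. For `v = 0` it says
    -- nothing, but any `x` nearly norming `f` has norm close to 1.
    by_cases hv : v = 0
    · obtain ⟨δ, hδ, hδη, hδf⟩ : ∃ δ : ℝ, 0 < δ ∧ δ ≤ η ∧ δ ≤ η * ‖f‖ :=
        ⟨min η (η * ‖f‖), lt_min hη (by positivity), min_le_left _ _, min_le_right _ _⟩
      obtain ⟨x, hx, hfx⟩ := exists_lt_apply_of_lt_norm (sub_lt_self ‖f‖ hδ)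
      refine ⟨x, hx, ?_, ?_⟩
      · linarith [le_abs_self (f x)]
      · have h1 : f x ≤ ‖f‖ * ‖x‖ := (le_abs_self _).trans (f.le_opNorm x)
        simp only [hv, norm_zero, mul_zero, add_zero, smul_zero]
        refine le_of_mul_le_mul_left ?_ hfp
        linarith
    · have hvp : 0 < ‖v‖ := norm_pos_iff.2 hv
      obtain ⟨x, hx, hfx⟩ := IsWeakStarDenseIn.exists_norm_add_smul hZ hd hf v
        (show 0 < min η (η * ‖v‖) from lt_min hη (by positivity))
      have h1 := min_le_left η (η * ‖v‖)
      have h2 := min_le_right η (η * ‖v‖)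
      refine ⟨x, hx, ?_, by linarith⟩
      have h3 : ‖x + f x • v‖ ≤ 1 + |f x| * ‖v‖ := by
        refine (norm_add_le _ _).trans ?_
        rw [norm_smul, Real.norm_eq_abs]
        gcongr
      refine le_of_mul_le_mul_right ?_ hvp
      linarith
  refine le_of_forall_pos_le_add fun ε hε => ?_
  obtain ⟨x, hx, hfx, hxv⟩ := happrox (ε / (1 + ‖z‖)) (by positivity)
  have h1 := hbound x hx
  have h2 : (‖f‖ - ε / (1 + ‖z‖)) * ‖z‖ ≤ |f x| * ‖z‖ := by gcongr
  have h3 : ε / (1 + ‖z‖) + ε / (1 + ‖z‖) * ‖z‖ = ε := by field_simp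
  linarith

end LEmbedded

theorem theorem3p4 (X : Type*) [NormedAddCommGroup X] [NormedSpace ℝ X] [CompleteSpace X]
    [TopologicalSpace.SeparableSpace X]
    (Z : Submodule ℝ (StrongDual ℝ (StrongDual ℝ X)))
    (hZ : IsL1DirectSum (E := StrongDual ℝ (StrongDual ℝ X)) (canonicalImage X) Z) :
    List.TFAE
      [DaugavetProperty (StrongDual ℝ X),
       DaugavetProperty X,
       IsWeakStarDenseIn ((Z : Set (StrongDual ℝ (StrongDual ℝ X))) ∩ Metric.closedBall 0 1)
         (Metric.closedBall (0 : StrongDual ℝ (StrongDual ℝ X)) 1)] := by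
  tfae_have 1 → 2 := DaugavetProperty.of_strongDual
  tfae_have 2 → 3 := fun h => h.isWeakStarDenseIn hZ
  tfae_have 3 → 1 := fun h => IsWeakStarDenseIn.daugavetProperty_strongDual hZ h
  tfae_finish
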